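/- Let $(\mathcal X,\Sigma)$ be a standard Borel space, $\mathcal T$ a set, and $d:\mathcal T\times\mathcal T\to[0,1]$ a premetric, i.e. $d(t,t')=d(t',t)$ and $d(t,t)=0$ (no triangle inequality is assumed). Assume that $(d,\mathcal T)$ is infinitely separable: there is a countable $\mathfrak T\subseteq\mathcal T$ such that for every $t\in\mathcal T$ there is a sequence $(t_n)$ in $\mathfrak T$, Cauchy with respect to $d$, with $d(t_n,t)\to0$ and $|\{t_n:n\in\mathbb N\}|=\infty$. Let $X=(X_t)_{t\in\mathcal T}$ be a stochastic process with values in $\mathcal X$ that is locally exchangeable with respect to $d$: for every finite $T\subset\mathcal T$ and every injection $\pi:T\to\mathcal T$, \[ \sup_{B\in\Sigma^{T}}\left|\Pr\big((X_t)_{t\in T}\in B\big)-\Pr\big((X_{\pi(t)})_{t\in T}\in B\big)\right|\le\sum_{t\in T}d(t,\pi(t)). \] Then there is a process $G=(G_t)_{t\in\mathcal T}$ of random probability measures on $\mathcal X$, defined on the probability space of $X$, such that for every finite $T\subset\mathcal T$ and all $t,t'\in\mathcal T$ \[ \Pr\big((X_s)_{s\in T}\in\cdot\,\big|\,G\big)=\prod_{s\in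 T}G_s\ \text{ a.s.},\qquad \sup_{A\in\Sigma}\mathbb E\left|G_t(A)-G_{t'}(A)\right|\le d(t,t'); \] it is unique up to modification (any other such process $G'$ on the same probability space satisfies $\Pr(G'_t=G_t)=1$ for every $t\in\mathcal T$); and for all $A\in\Sigma$, $t_0\in\mathcal T$ and $\epsilon>0$, \[ \lim_{\eta\downarrow0}\ \sup_{t\,:\,d(t,t_0)\le\eta}\Pr\left(|G_t(A)-G_{t_0}(A)|>\epsilon\right)=0 . \] -/

import Mathlib

open MeasureTheory Filter Topology
open scoped ENNReal

/-- A premetric with values in `[0, 1]`: symmetric and zero on the diagonal.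
No triangle inequality and no positivity off the diagonal is required. -/
structure IsUnitPremetric {I : Type*} (d : I → I → ℝ) : Prop where
  nonneg : ∀ s t, 0 ≤ d s t
  le_one : ∀ s t, d s t ≤ 1
  symm : ∀ s t, d s t = d t s
  self : ∀ t, d t t = 0

/-- `(d, I)` is infinitely separable: there is a countable subset `S` such that every point of `I`
is the limit of a Cauchy sequence in `S` that takes infinitely many distinct values. -/
def IsInfinitelySeparable {I : Type*} (d : I → I → ℝ) : Prop :=
  ∃ S : Set I, S.Countable ∧ ∀ t : I, ∃ u : ℕ → I,
    (∀ n, u n ∈ S) ∧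
    (∀ ε : ℝ, 0 < ε → ∃ N : ℕ, ∀ m n : ℕ, N ≤ m → N ≤ n → d (u m) (u n) < ε) ∧
    Tendsto (fun n => d (u n) t) atTop (𝓝 0) ∧
    (Set.range u).Infinite

/-- Total variation distance `sup_A |μ(A) - ν(A)|` over the measurable sets `A`. It is used below
for probability measures only, for which the supremum is over a set bounded by `1`. -/
noncomputable def tvDist {Y : Type*} [MeasurableSpace Y] (μ ν : Measure Y) : ℝ :=
  ⨆ A : {A : Set Y // MeasurableSet A}, |μ.real A.1 - ν.real A.1|

/-- `X` is locally exchangeable with respect to `d`: for every finite set `T` of covariates and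
every injection `π : T → I`, the laws of `(X_t)_{t ∈ T}` and `(X_{π(t)})_{t ∈ T}` on the product
space are within `∑_{t ∈ T} d(t, π(t))` of each other in total variation. -/
def IsLocallyExchangeable {I Ω E : Type*} [MeasurableSpace Ω] [MeasurableSpace E]
    (P : Measure Ω) (X : I → Ω → E) (d : I → I → ℝ) : Prop :=
  ∀ (T : Finset I) (π : T → I), Function.Injective π →
    tvDist (P.map (fun ω (t : T) => X t.1 ω)) (P.map (fun ω (t : T) => X (π t) ω))
      ≤ ∑ t : T, d t.1 (π t)

/-- The sub-σ-algebra of `Ω` generated by a measure-valued process `G`, where the space of measures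
carries the σ-algebra generated by the evaluations `μ ↦ μ A`. -/
abbrev processSigmaAlgebra {I Ω E : Type*} [MeasurableSpace E]
    (G : I → Ω → Measure E) : MeasurableSpace Ω :=
  ⨆ t : I, MeasurableSpace.comap (G t) inferInstance

/-- `G` is a de Finetti process of `X` with respect to `d`: a process of random probability
measures on `E` such that, for every finite `T`, the product `∏_{t ∈ T} G_t` is a version of the
conditional law of `(X_t)_{t ∈ T}` given `G`, and `sup_A 𝔼|G_s(A) - G_t(A)| ≤ d(s, t)`. -/
structure IsDeFinettiProcess {I Ω E : Type*} [MeasurableSpace Ω] [MeasurableSpace E]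
    (P : Measure Ω) (X : I → Ω → E) (d : I → I → ℝ) (G : I → Ω → Measure E) : Prop where
  measurable : ∀ t, Measurable (G t)
  isProbabilityMeasure : ∀ t ω, IsProbabilityMeasure (G t ω)
  condLaw : ∀ (T : Finset I) (B : Set (T → E)), MeasurableSet B →
    P[((fun ω (t : T) => X t.1 ω) ⁻¹' B).indicator (fun _ => (1 : ℝ)) | processSigmaAlgebra G]
      =ᵐ[P] fun ω => (Measure.pi (fun t : T => G t.1 ω)).real B
  smooth : ∀ (s t : I) (A : Set E), MeasurableSet A →
    ∫ ω, |(G s ω).real A - (G t ω).real A| ∂P ≤ d s t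

/-! Take `G t` to be the conditional law of `X t` given all the other coordinates. The key point
(`condExp_coord_ae_eq`) is that dropping one more coordinate `t` from the conditioning does not
change the conditional law of `X s`: every ball around `t` is infinite, so there are distinct `v n`
with `d (v n) t → 0`, and local exchangeability lets `X (v n)` stand in for `X t` asymptotically in
joint events with the other coordinates.

Hence, up to null sets, each `G s` is measurable without the coordinate `a`, for every `a`. In the
integral of a product of indicators of `X t ∈ A t` times a σ(G)-measurable weight, the indicators
can then be replaced by `G t (A t)` one at a time (`integral_prod_eq`); this is the conditional
product law. Also `G s` and `G t` become conditional expectations over the common σ-algebra of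
coordinates outside `{s, t}`, and the L¹ bound follows from swapping `s` and `t` in a single event.

For uniqueness, a second-moment computation valid for any de Finetti process shows that averages of
indicators of `X r ∈ A`, over many `r` close to `t`, approximate `G t A` in L². The averages do not
involve `G`. Continuity in probability is Markov's inequality applied to the L¹ bound. -/

section

variable {I Ω E : Type*}

/-- The σ-algebra generated by the coordinates `X r`, `r ∈ J`. -/
@[reducible]
def coordSigma [MeasurableSpace E] (X : I → Ω → E) (J : Set I) : MeasurableSpace Ω :=
  MeasurableSpace.comap (fun ω (r : J) => X r ω) MeasurableSpace.pi

/-! ### σ-algebras generated by sets of coordinates. -/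

section coordSigma

variable [MeasurableSpace E] {X : I → Ω → E} {J K : Set I}

lemma coordSigma_le [MeasurableSpace Ω] (hX : ∀ t, Measurable (X t)) (J : Set I) :
    coordSigma X J ≤ ‹MeasurableSpace Ω› :=
  (measurable_pi_lambda _ fun r : J => hX r).comap_le

lemma measurable_coordSigma {r : I} (hr : r ∈ J) : Measurable[coordSigma X J] (X r) := by
  have h : Measurable[coordSigma X J] (fun ω (r : J) => X r ω) := comap_measurable _
  exact (measurable_pi_apply (⟨r, hr⟩ : J)).comp h

lemma coordSigma_le_iff {m : MeasurableSpace Ω} :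
    coordSigma X J ≤ m ↔ ∀ r ∈ J, Measurable[m] (X r) := by
  refine ⟨fun h r hr => (measurable_coordSigma hr).mono h le_rfl, fun h => ?_⟩
  exact (measurable_pi_lambda _ fun r : J => h r r.2).comap_le

lemma coordSigma_mono (h : J ⊆ K) : coordSigma X J ≤ coordSigma X K :=
  coordSigma_le_iff.2 fun _ hr => measurable_coordSigma (h hr)

/-- Isolates the coordinate `t` in a π-system, so that a π-λ argument only has to treat events `Q ∩
{X t ∈ C}` with `Q` free of `t`. -/
lemma coordSigma_insert_eq_generateFrom (t : I) :
    coordSigma X (insert t J) = MeasurableSpace.generateFrom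
      {H | ∃ Q C, MeasurableSet[coordSigma X J] Q ∧ MeasurableSet C ∧ H = Q ∩ X t ⁻¹' C} := by
  apply le_antisymm
  · refine coordSigma_le_iff.2 fun r hr C hC => MeasurableSpace.measurableSet_generateFrom ?_
    rcases hr with rfl | hr
    · exact ⟨Set.univ, C, MeasurableSet.univ, hC, by simp⟩
    · exact ⟨X r ⁻¹' C, Set.univ, measurable_coordSigma hr hC, MeasurableSet.univ, by simp⟩
  · refine MeasurableSpace.generateFrom_le ?_
    rintro _ ⟨Q, C, hQ, hC, rfl⟩
    exact (coordSigma_mono (Set.subset_insert t J) _ hQ).inter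
      (measurable_coordSigma (Set.mem_insert t J) hC)

lemma isPiSystem_inter_coord (t : I) :
    IsPiSystem {H | ∃ Q C, MeasurableSet[coordSigma X J] Q ∧ MeasurableSet C ∧
      H = Q ∩ X t ⁻¹' C} := by
  rintro _ ⟨Q, C, hQ, hC, rfl⟩ _ ⟨Q', C', hQ', hC', rfl⟩ -
  exact ⟨Q ∩ Q', C ∩ C', MeasurableSet.inter hQ hQ', hC.inter hC', by
    rw [Set.preimage_inter, Set.inter_inter_inter_comm]⟩

end coordSigma

/-! ### Local exchangeability and approach to a point through distinct indices. -/

lemma abs_measureReal_sub_le_tvDist {Y : Type*} [MeasurableSpace Y] (μ ν : Measure Y)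
    [IsProbabilityMeasure μ] [IsProbabilityMeasure ν] {A : Set Y} (hA : MeasurableSet A) :
    |μ.real A - ν.real A| ≤ tvDist μ ν := by
  refine le_ciSup (f := fun A : {A : Set Y // MeasurableSet A} => |μ.real A.1 - ν.real A.1|)
    ⟨1, ?_⟩ ⟨A, hA⟩
  rintro _ ⟨B, rfl⟩
  exact abs_sub_le_of_nonneg_of_le measureReal_nonneg measureReal_le_one measureReal_nonneg
    measureReal_le_one

/-- Only finitely many terms of the approximating sequence lie outside the ball, while its range is
infinite. -/
lemma IsInfinitelySeparable.infinite_setOf_lt {d : I → I → ℝ} (h : IsInfinitelySeparable d)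
    (t : I) {ε : ℝ} (hε : 0 < ε) : {r | d r t < ε}.Infinite := by
  obtain ⟨S, -, hS⟩ := h
  obtain ⟨u, -, -, hu, hinf⟩ := hS t
  obtain ⟨N, hN⟩ := eventually_atTop.1 (hu.eventually (gt_mem_nhds hε))
  intro hfin
  refine hinf ((hfin.union ((Finset.range N).finite_toSet.image u)).subset ?_)
  rintro _ ⟨n, rfl⟩
  rcases le_or_gt N n with hn | hn
  · exact Or.inl (hN n hn)
  · exact Or.inr ⟨n, by simpa using hn, rfl⟩

/-- Points are chosen recursively, each new and closer than required before. The recursion runs over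
pairs (precision, point): strictly increasing precisions force convergence. -/
lemma exists_injective_tendsto {d : I → I → ℝ} (hd : ∀ s t, 0 ≤ d s t) (t : I)
    (h : ∀ ε : ℝ, 0 < ε → {r | d r t < ε}.Infinite) :
    ∃ v : ℕ → I, Function.Injective v ∧ Tendsto (fun n => d (v n) t) atTop (𝓝 0) := by
  obtain ⟨f, hf, hr⟩ := exists_seq_of_forall_finset_exists (α := ℕ × I)
    (fun x => d x.2 t < 1 / ((x.1 : ℝ) + 1)) (fun x y => x.1 < y.1 ∧ x.2 ≠ y.2) (by
      classical
      intro s _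
      obtain ⟨i, hi, his⟩ := (h (1 / (((s.sup Prod.fst + 1 : ℕ) : ℝ) + 1))
        (by positivity)).exists_notMem_finset (s.image Prod.snd)
      refine ⟨(s.sup Prod.fst + 1, i), hi, fun x hx => ⟨?_, fun hxi => his ?_⟩⟩
      · exact Nat.lt_succ_of_le (Finset.le_sup (f := Prod.fst) hx)
      · exact Finset.mem_image.2 ⟨x, hx, hxi⟩)
  have hmono : StrictMono fun n => (f n).1 := fun m n hmn => (hr m n hmn).1
  refine ⟨fun n => (f n).2, fun m n hmn => ?_, ?_⟩
  · rcases lt_trichotomy m n with hlt | heq | hlt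
    · exact absurd hmn (hr m n hlt).2
    · exact heq
    · exact absurd hmn.symm (hr n m hlt).2
  · exact squeeze_zero (fun n => hd _ _) (fun n => (hf n).le)
      (tendsto_one_div_add_atTop_nhds_zero_nat.comp hmono.tendsto_atTop)

variable [MeasurableSpace Ω] [MeasurableSpace E] {P : Measure Ω} [IsProbabilityMeasure P]
  {d : I → I → ℝ} {X : I → Ω → E}

/-- The injection is the transposition of `s` and `t` on `insert s R`. It fixes `R`, where the
diagonal terms of `d` vanish, so the sum collapses to `d s t`. -/
lemma IsLocallyExchangeable.abs_sub_le (hd : IsUnitPremetric d)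
    (hX : ∀ t, Measurable (X t)) (hloc : IsLocallyExchangeable P X d) {R : Finset I} {s t : I}
    (hs : s ∉ R) (ht : t ∉ R) {B : Set (E × (R → E))} (hB : MeasurableSet B) :
    |P.real {ω | (X s ω, fun r : R => X r ω) ∈ B} - P.real {ω | (X t ω, fun r : R => X r ω) ∈ B}|
      ≤ d s t := by
  classical
  set T : Finset I := insert s R with hT
  let π : T → I := fun r => Equiv.swap s t r
  have hπ : Function.Injective π := (Equiv.swap s t).injective.comp Subtype.val_injective
  have hπR : ∀ r : R, Equiv.swap s t r.1 = r.1 := fun r =>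
    Equiv.swap_apply_of_ne_of_ne (fun h => hs (h ▸ r.2)) (fun h => ht (h ▸ r.2))
  let φ : (T → E) → E × (R → E) := fun x =>
    (x ⟨s, Finset.mem_insert_self s R⟩, fun r => x ⟨r, Finset.mem_insert_of_mem r.2⟩)
  have hφ : Measurable φ := by fun_prop
  have h1 : Measurable fun ω (r : T) => X r.1 ω := measurable_pi_lambda _ fun r => hX _
  have h2 : Measurable fun ω (r : T) => X (π r) ω := measurable_pi_lambda _ fun r => hX _
  have := Measure.isProbabilityMeasure_map (μ := P) h1.aemeasurable
  have := Measure.isProbabilityMeasure_map (μ := P) h2.aemeasurable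
  have key := (abs_measureReal_sub_le_tvDist (P.map fun ω (r : T) => X r.1 ω)
    (P.map fun ω (r : T) => X (π r) ω) (hφ hB)).trans (hloc T π hπ)
  rw [map_measureReal_apply h1 (hφ hB), map_measureReal_apply h2 (hφ hB)] at key
  have hsum : ∑ r : T, d r.1 (π r) = d s t := by
    rw [Finset.sum_coe_sort T (fun r => d r (Equiv.swap s t r)), hT, Finset.sum_insert hs,
      Equiv.swap_apply_left, Finset.sum_eq_zero, add_zero]
    intro r hr
    rw [hπR ⟨r, hr⟩, hd.self]
  rw [hsum] at key
  have e1 : ∀ ω, φ (fun r => X r.1 ω) = (X s ω, fun r : R => X r ω) := fun ω => rfl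
  have e2 : ∀ ω, φ (fun r => X (π r) ω) = (X t ω, fun r : R => X r ω) := fun ω => by
    simp only [φ, π, hπR, Equiv.swap_apply_left]
  simpa only [Set.preimage, Set.mem_ofPred_eq, e1, e2] using key

/-- Cylinders form an algebra generating the product σ-algebra, hence are dense in measure. This
brings events in infinitely many coordinates within reach of a hypothesis about finite sets. -/
lemma exists_cylinder_approx (hX : ∀ t, Measurable (X t)) {J : Set I} {Q : Set Ω}
    (hQ : MeasurableSet[coordSigma X J] Q) {ε : ℝ} (hε : 0 < ε) :
    ∃ R : Finset I, ↑R ⊆ J ∧ ∃ B : Set (R → E), MeasurableSet B ∧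
      P.real (symmDiff Q {ω | (fun r : R => X r ω) ∈ B}) < ε := by
  classical
  obtain ⟨S, hS, rfl⟩ := hQ
  have hm : Measurable fun ω (r : J) => X r ω := measurable_pi_lambda _ fun r => hX _
  have := Measure.isProbabilityMeasure_map (μ := P) hm.aemeasurable
  obtain ⟨C, hC, hlt⟩ := (Measure.MeasureDense.of_generateFrom_isSetAlgebra_finite
    (μ := P.map fun ω (r : J) => X r ω) isSetAlgebra_measurableCylinders
    generateFrom_measurableCylinders.symm).approx S hS (measure_ne_top _ _) ε hε
  obtain ⟨R', D, hD, rfl⟩ := (mem_measurableCylinders _).1 hC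
  have hmem : ∀ r : R', (r.1 : I) ∈ R'.map (Function.Embedding.subtype _) := fun r =>
    Finset.mem_map_of_mem _ r.2
  refine ⟨R'.map (Function.Embedding.subtype _), by simp,
    (fun (x : R'.map (Function.Embedding.subtype _) → E) (r : R') => x ⟨r.1.1, hmem r⟩) ⁻¹' D,
    (by fun_prop : Measurable _) hD, ?_⟩
  rw [Measure.map_apply hm (hS.symmDiff hD.cylinder)] at hlt
  exact (ENNReal.toReal_lt_of_lt_ofReal hlt)

lemma abs_measureReal_inter_sub_le {Q Q' V : Set Ω} (hQ : MeasurableSet Q)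
    (hQ' : MeasurableSet Q') (hV : MeasurableSet V) :
    |P.real (Q ∩ V) - P.real (Q' ∩ V)| ≤ P.real (symmDiff Q Q') := by
  refine (abs_measureReal_sub_le_measureReal_symmDiff (hQ.inter hV).nullMeasurableSet
    (hQ'.inter hV).nullMeasurableSet).trans
    (measureReal_mono ?_)
  intro ω
  simp only [Set.mem_symmDiff, Set.mem_inter_iff]
  tauto

/-- `Q` may itself depend on the coordinates `v n`. After approximation by a cylinder over a finite
`R`, injectivity makes `v n` leave `R`, and the transposition bound applies. -/
lemma tendsto_measureReal_inter_coord (hd : IsUnitPremetric d) (hX : ∀ t, Measurable (X t))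
    (hloc : IsLocallyExchangeable P X d) {t : I} {v : ℕ → I} (hv : Function.Injective v)
    (hvt : Tendsto (fun n => d (v n) t) atTop (𝓝 0)) {Q : Set Ω}
    (hQ : MeasurableSet[coordSigma X {t}ᶜ] Q) {C : Set E} (hC : MeasurableSet C) :
    Tendsto (fun n => P.real (Q ∩ X (v n) ⁻¹' C)) atTop (𝓝 (P.real (Q ∩ X t ⁻¹' C))) := by
  rw [Metric.tendsto_atTop']
  intro ε hε
  obtain ⟨R, hR, B, hB, hlt⟩ := exists_cylinder_approx (P := P) hX hQ (ε := ε / 3) (by positivity)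
  have htR : t ∉ R := fun h => hR h rfl
  have hevR : ∀ᶠ n in atTop, v n ∉ R := by
    rw [← Nat.cofinite_eq_atTop]
    exact hv.tendsto_cofinite R.finite_toSet.compl_mem_cofinite
  obtain ⟨N, hN⟩ := eventually_atTop.1
    (hevR.and (hvt.eventually (gt_mem_nhds (show 0 < ε / 3 by positivity))))
  refine ⟨N, fun n hn => ?_⟩
  obtain ⟨hnR, hnd⟩ := hN n hn.le
  have hQm : MeasurableSet Q := coordSigma_le hX _ _ hQ
  have hRm : Measurable fun ω (r : R) => X r ω := measurable_pi_lambda _ fun r => hX _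
  have hQ'm : MeasurableSet {ω | (fun r : R => X r ω) ∈ B} := hRm hB
  have h1 := abs_measureReal_inter_sub_le (P := P) hQm hQ'm (hX (v n) hC)
  have h2 := abs_measureReal_inter_sub_le (P := P) hQm hQ'm (hX t hC)
  have h3 := hloc.abs_sub_le hd hX hnR htR (hC.prod hB)
  have e : ∀ r : I, {ω | (X r ω, fun r : R => X r ω) ∈ C ×ˢ B}
      = {ω | (fun r : R => X r ω) ∈ B} ∩ X r ⁻¹' C := by
    intro r; ext ω; simp [and_comm]
  rw [e, e] at h3
  rw [Real.dist_eq]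
  rw [abs_le] at h1 h2 h3
  rw [abs_lt]
  constructor <;> linarith

/-- Layer-cake formula: the integral is that of the measures of superlevel sets, to which the event
version and dominated convergence apply. -/
lemma tendsto_setIntegral_coord (hd : IsUnitPremetric d) (hX : ∀ t, Measurable (X t))
    (hloc : IsLocallyExchangeable P X d) {t : I} {v : ℕ → I} (hv : Function.Injective v)
    (hvt : Tendsto (fun n => d (v n) t) atTop (𝓝 0)) {g : Ω → ℝ}
    (hg : Measurable[coordSigma X {t}ᶜ] g) (hg0 : ∀ ω, 0 ≤ g ω) (hg1 : ∀ ω, g ω ≤ 1)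
    {C : Set E} (hC : MeasurableSet C) :
    Tendsto (fun n => ∫ ω in X (v n) ⁻¹' C, g ω ∂P) atTop (𝓝 (∫ ω in X t ⁻¹' C, g ω ∂P)) := by
  have hgm : Measurable g := hg.mono (coordSigma_le hX _) le_rfl
  have hint : Integrable g P := Integrable.of_bound hgm.aestronglyMeasurable 1
    (ae_of_all _ fun ω => by rw [Real.norm_of_nonneg (hg0 ω)]; exact hg1 ω)
  have e : ∀ r : I, ∫ ω in X r ⁻¹' C, g ω ∂P
      = ∫ x in Set.Ioc (0 : ℝ) 1, P.real ({ω | x ≤ g ω} ∩ X r ⁻¹' C) := by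
    intro r
    rw [hint.integrableOn.integral_eq_integral_Ioc_meas_le (ae_of_all _ hg0) (ae_of_all _ hg1)]
    congr 1 with x
    rw [measureReal_restrict_apply (measurableSet_le measurable_const hgm)]
  simp_rw [e]
  refine tendsto_integral_of_dominated_convergence (fun _ => 1) (fun n => ?_)
    (integrable_const _) (fun n => ae_of_all _ fun x => ?_) (ae_of_all _ fun x => ?_)
  · refine Measurable.aestronglyMeasurable (Antitone.measurable fun x y hxy => ?_)
    exact measureReal_mono (Set.inter_subset_inter_left _ fun ω h => hxy.trans h)
  · rw [Real.norm_of_nonneg measureReal_nonneg]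
    exact measureReal_le_one
  · exact tendsto_measureReal_inter_coord hd hX hloc hv hvt (hg measurableSet_Ici) hC

end

/-! ### Conditional law of a coordinate given the others. -/

section

/-- Truncation makes the bounds hold everywhere, as the layer-cake step requires. -/
lemma exists_unit_version_condExp {Ω : Type*} {m m₀ : MeasurableSpace Ω} {P : Measure Ω}
    [IsProbabilityMeasure P] (hm : m ≤ m₀) {F : Set Ω} (hF : MeasurableSet F) :
    ∃ g : Ω → ℝ, Measurable[m] g ∧ (∀ ω, 0 ≤ g ω) ∧ (∀ ω, g ω ≤ 1) ∧
      g =ᵐ[P] P[F.indicator (fun _ => (1 : ℝ)) | m] := by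
  have hint : Integrable (F.indicator fun _ => (1 : ℝ)) P := (integrable_const _).indicator hF
  refine ⟨fun ω => max 0 (min 1 (P[F.indicator (fun _ => (1 : ℝ)) | m] ω)), ?_,
    fun ω => le_max_left _ _, fun ω => max_le zero_le_one (min_le_left _ _), ?_⟩
  · exact measurable_const.max (measurable_const.min stronglyMeasurable_condExp.measurable)
  · have h0 : 0 ≤ᵐ[P] P[F.indicator (fun _ => (1 : ℝ)) | m] :=
      condExp_nonneg (ae_of_all _ fun ω => Set.indicator_nonneg (fun _ _ => zero_le_one) ω)
    have h1 : P[F.indicator (fun _ => (1 : ℝ)) | m] ≤ᵐ[P] P[fun _ => (1 : ℝ) | m] :=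
      condExp_mono hint (integrable_const _)
        (ae_of_all _ fun ω => Set.indicator_le_self' (fun _ _ => zero_le_one) ω)
    rw [condExp_const hm (1 : ℝ)] at h1
    filter_upwards [h0, h1] with ω h0 h1
    rw [min_eq_right h1]
    exact max_eq_right h0

variable {I Ω E : Type*} [MeasurableSpace Ω] [MeasurableSpace E] {P : Measure Ω}
  [IsProbabilityMeasure P] {d : I → I → ℝ} {X : I → Ω → E}

/-- The smaller conditional expectation `g` has the right integrals over `Q ∩ {X (v n) ∈ C}`, since
`v n` differs from `s` and `t` eventually. Both sides converge as `v n` approaches `t`, giving the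
right integrals over `Q ∩ {X t ∈ C}`; such events generate the larger σ-algebra. -/
lemma condExp_coord_ae_eq (hd : IsUnitPremetric d) (hX : ∀ t, Measurable (X t))
    (hsep : ∀ t, ∀ ε : ℝ, 0 < ε → {r | d r t < ε}.Infinite)
    (hloc : IsLocallyExchangeable P X d) {s t : I} (hst : s ≠ t) {A : Set E}
    (hA : MeasurableSet A) :
    P[(X s ⁻¹' A).indicator (fun _ => (1 : ℝ)) | coordSigma X {s}ᶜ]
      =ᵐ[P] P[(X s ⁻¹' A).indicator (fun _ => (1 : ℝ)) | coordSigma X {s, t}ᶜ] := by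
  have hm := coordSigma_le hX {s, t}ᶜ
  have hms := coordSigma_le hX {s}ᶜ
  have hint : Integrable ((X s ⁻¹' A).indicator fun _ => (1 : ℝ)) P :=
    (integrable_const _).indicator (hX s hA)
  obtain ⟨g, hg, hg0, hg1, hge⟩ := exists_unit_version_condExp (P := P) hm (hX s hA)
  refine EventuallyEq.symm (hge.symm.trans ?_)
  have hgi : Integrable g P := integrable_condExp.congr hge.symm
  have hle : coordSigma X {s, t}ᶜ ≤ coordSigma X {s}ᶜ :=
    coordSigma_mono (Set.compl_subset_compl.2 (by simp))
  have hlet : coordSigma X {s, t}ᶜ ≤ coordSigma X {t}ᶜ :=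
    coordSigma_mono (Set.compl_subset_compl.2 (by simp))
  have hgF : ∀ Q, MeasurableSet[coordSigma X {s, t}ᶜ] Q → ∫ ω in Q, g ω ∂P
      = ∫ ω in Q, (X s ⁻¹' A).indicator (fun _ => (1 : ℝ)) ω ∂P := fun Q hQ => by
    rw [← setIntegral_condExp hm hint hQ]
    exact setIntegral_congr_ae (hm _ hQ) (hge.mono fun _ h _ => h)
  obtain ⟨v, hv, hvt⟩ := exists_injective_tendsto hd.nonneg t (hsep t)
  have heq : coordSigma X {s}ᶜ = coordSigma X (insert t {s, t}ᶜ) := by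
    congr 1
    ext r
    by_cases hr : r = t <;> simp [hr, hst.symm]
  refine ae_eq_condExp_of_forall_setIntegral_eq hms hint (fun _ _ _ => hgi.integrableOn) ?_
    (hg.mono hle le_rfl).aestronglyMeasurable
  rintro H hH -
  induction H, hH using MeasurableSpace.induction_on_inter
    (heq.trans (coordSigma_insert_eq_generateFrom t)) (isPiSystem_inter_coord t) with
  | empty => simp
  | basic H hH =>
    obtain ⟨Q, C, hQ, hC, rfl⟩ := hH
    have key : ∀ h : Ω → ℝ, Measurable[coordSigma X {t}ᶜ] h → (∀ ω, 0 ≤ h ω) → (∀ ω, h ω ≤ 1) →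
        Tendsto (fun n => ∫ ω in Q ∩ X (v n) ⁻¹' C, h ω ∂P) atTop
          (𝓝 (∫ ω in Q ∩ X t ⁻¹' C, h ω ∂P)) := fun h hh h0 h1 => by
      have := tendsto_setIntegral_coord (P := P) hd hX hloc hv hvt
        (g := Q.indicator h) (hh.indicator (hlet _ hQ))
        (fun ω => Set.indicator_nonneg (fun _ _ => h0 _) ω)
        (fun ω => Set.indicator_apply_le' (fun _ => h1 _) fun _ => zero_le_one) hC
      simpa only [setIntegral_indicator (hm _ hQ), Set.inter_comm] using this
    have hsm : MeasurableSet[coordSigma X {t}ᶜ] (X s ⁻¹' A) :=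
      measurable_coordSigma (by simpa using hst) hA
    refine tendsto_nhds_unique (key g (hg.mono hlet le_rfl) hg0 hg1) ((key _
      (measurable_const.indicator hsm) (fun ω => Set.indicator_nonneg (fun _ _ => zero_le_one) ω)
      (fun ω => Set.indicator_apply_le' (fun _ => le_rfl) fun _ => zero_le_one)).congr' ?_)
    -- From here on the event lies in the smaller σ-algebra, where `g` and the indicator have equal
    -- integrals.
    have hev : ∀ᶠ n in atTop, v n ∈ ({s, t} : Set I)ᶜ := by
      rw [← Nat.cofinite_eq_atTop]
      exact hv.tendsto_cofinite ((Set.toFinite {s, t}).compl_mem_cofinite)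
    filter_upwards [hev] with n hn
    exact (hgF _ (MeasurableSet.inter hQ (measurable_coordSigma hn hC))).symm
  | compl H hH ih =>
    have hu := hgF Set.univ MeasurableSet.univ
    rw [setIntegral_univ, setIntegral_univ] at hu
    rw [setIntegral_compl (hms _ hH) hgi, setIntegral_compl (hms _ hH) hint, ih, hu]
  | iUnion f hdisj hf ih =>
    rw [integral_iUnion (fun i => hms _ (hf i)) hdisj hgi.integrableOn,
      integral_iUnion (fun i => hms _ (hf i)) hdisj hint.integrableOn]
    simp_rw [ih]

/-- `G` is a process of random probability measures such that each `G t` is a version of the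
conditional law of `X t` given all the other coordinates. -/
structure IsCoordCondLaw (P : Measure Ω) (X : I → Ω → E) (G : I → Ω → Measure E) : Prop where
  measurable : ∀ t, Measurable (G t)
  isProbabilityMeasure : ∀ t ω, IsProbabilityMeasure (G t ω)
  condExp_eq : ∀ t A, MeasurableSet A → (fun ω => (G t ω).real A)
    =ᵐ[P] P[(X t ⁻¹' A).indicator (fun _ => (1 : ℝ)) | coordSigma X {t}ᶜ]

lemma exists_isCoordCondLaw [StandardBorelSpace E] (P : Measure Ω) [IsProbabilityMeasure P]
    (hX : ∀ t, Measurable (X t)) : ∃ G, IsCoordCondLaw P X G := by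
  -- `condDistrib` needs `E` nonempty, which follows from the existence of an index.
  by_cases hI : IsEmpty I
  · exact ⟨fun t => hI.elim t, fun t => hI.elim t, fun t => hI.elim t, fun t => hI.elim t⟩
  have : Nonempty I := not_isEmpty_iff.1 hI
  have : Nonempty Ω := nonempty_of_isProbabilityMeasure P
  have : Nonempty E := ⟨X (Classical.arbitrary I) (Classical.arbitrary Ω)⟩
  have hZ : ∀ t, Measurable fun ω (r : ({t}ᶜ : Set I)) => X r ω := fun t =>
    measurable_pi_lambda _ fun r => hX _
  refine ⟨fun t ω => ProbabilityTheory.condDistrib (X t) (fun ω (r : ({t}ᶜ : Set I)) => X r ω) P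
    (fun r => X r ω), fun t => ?_, fun t ω => inferInstance, fun t A hA => ?_⟩
  · exact (ProbabilityTheory.Kernel.measurable _).comp (hZ t)
  · exact ProbabilityTheory.condDistrib_ae_eq_condExp (hZ t) (hX t) hA

lemma IsCoordCondLaw.condExp_pair_eq {G : I → Ω → Measure E} (hG : IsCoordCondLaw P X G)
    (hd : IsUnitPremetric d) (hX : ∀ t, Measurable (X t))
    (hsep : ∀ t, ∀ ε : ℝ, 0 < ε → {r | d r t < ε}.Infinite)
    (hloc : IsLocallyExchangeable P X d) {s t : I} (hst : s ≠ t) {A : Set E}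
    (hA : MeasurableSet A) : (fun ω => (G s ω).real A)
      =ᵐ[P] P[(X s ⁻¹' A).indicator (fun _ => (1 : ℝ)) | coordSigma X {s, t}ᶜ] :=
  (hG.condExp_eq s A hA).trans (condExp_coord_ae_eq hd hX hsep hloc hst hA)

lemma IsCoordCondLaw.aestronglyMeasurable {G : I → Ω → Measure E} (hG : IsCoordCondLaw P X G)
    (hd : IsUnitPremetric d) (hX : ∀ t, Measurable (X t))
    (hsep : ∀ t, ∀ ε : ℝ, 0 < ε → {r | d r t < ε}.Infinite)
    (hloc : IsLocallyExchangeable P X d) (s t : I) {A : Set E}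
    (hA : MeasurableSet A) :
    AEStronglyMeasurable[coordSigma X {t}ᶜ] (fun ω => (G s ω).real A) P := by
  rcases eq_or_ne s t with rfl | hst
  · exact ⟨_, stronglyMeasurable_condExp, hG.condExp_eq s A hA⟩
  · exact ⟨_, stronglyMeasurable_condExp.mono
      (coordSigma_mono (Set.compl_subset_compl.2 (by simp))),
      hG.condExp_pair_eq hd hX hsep hloc hst hA⟩

/-! ### Conditional product law given `G`. -/

lemma IsCoordCondLaw.integral_mul_eq {G : I → Ω → Measure E} (hG : IsCoordCondLaw P X G)
    (hX : ∀ t, Measurable (X t)) {a : I} {A : Set E} (hA : MeasurableSet A) {V : Ω → ℝ} {c : ℝ}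
    (hV : AEStronglyMeasurable[coordSigma X {a}ᶜ] V P) (hVc : ∀ ω, ‖V ω‖ ≤ c) :
    ∫ ω, V ω * (X a ⁻¹' A).indicator (fun _ => (1 : ℝ)) ω ∂P = ∫ ω, V ω * (G a ω).real A ∂P := by
  have hm := coordSigma_le hX {a}ᶜ
  have h := condExp_stronglyMeasurable_mul_of_bound₀ hm hV
    ((integrable_const (1 : ℝ)).indicator (hX a hA)) c (ae_of_all P hVc)
  have h' : ∫ ω, (V * (X a ⁻¹' A).indicator (fun _ => (1 : ℝ))) ω ∂P = _ :=
    (integral_condExp hm).symm.trans (integral_congr_ae h)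
  refine h'.trans (integral_congr_ae ?_)
  filter_upwards [hG.condExp_eq a A hA] with ω hω
  rw [Pi.mul_apply, ← hω]

/-- Induction on `T` with the weight `V` general: once the indicator at `a` is replaced, `G a (A a)`
is absorbed into `V`. This is allowed because it is a.e. measurable without any given coordinate. -/
lemma IsCoordCondLaw.integral_prod_eq {G : I → Ω → Measure E} (hG : IsCoordCondLaw P X G)
    (hd : IsUnitPremetric d) (hX : ∀ t, Measurable (X t))
    (hsep : ∀ t, ∀ ε : ℝ, 0 < ε → {r | d r t < ε}.Infinite)
    (hloc : IsLocallyExchangeable P X d) (T : Finset I) {A : I → Set E}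
    (hA : ∀ t, MeasurableSet (A t)) (V : Ω → ℝ)
    (hV : ∀ a, AEStronglyMeasurable[coordSigma X {a}ᶜ] V P) (hVc : ∀ ω, ‖V ω‖ ≤ 1) :
    ∫ ω, V ω * ∏ t ∈ T, (X t ⁻¹' A t).indicator (fun _ => (1 : ℝ)) ω ∂P
      = ∫ ω, V ω * ∏ t ∈ T, (G t ω).real (A t) ∂P := by
  classical
  have := hG.isProbabilityMeasure
  induction T using Finset.induction_on generalizing V with
  | empty => simp
  | insert a T ha ih =>
    have h1 : ∀ ω, ‖∏ t ∈ T, (X t ⁻¹' A t).indicator (fun _ => (1 : ℝ)) ω‖ ≤ 1 := fun ω => by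
      rw [Real.norm_of_nonneg (Finset.prod_nonneg fun t _ =>
        Set.indicator_nonneg (fun _ _ => zero_le_one) ω)]
      exact Finset.prod_le_one (fun t _ => Set.indicator_nonneg (fun _ _ => zero_le_one) ω)
        fun t _ => Set.indicator_apply_le' (fun _ => le_rfl) fun _ => zero_le_one
    have hm : AEStronglyMeasurable[coordSigma X {a}ᶜ]
        (fun ω => ∏ t ∈ T, (X t ⁻¹' A t).indicator (fun _ => (1 : ℝ)) ω) P := by
      refine (Measurable.stronglyMeasurable (Finset.measurable_fun_prod T fun t ht =>
        measurable_const.indicator (measurable_coordSigma ?_ (hA t)))).aestronglyMeasurable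
      rintro rfl
      exact ha ht
    have step := hG.integral_mul_eq (a := a) (c := 1) hX (hA a) ((hV a).mul hm) fun ω => by
      rw [Pi.mul_apply, norm_mul]
      exact mul_le_one₀ (hVc ω) (norm_nonneg _) (h1 ω)
    have step2 := ih (fun ω => V ω * (G a ω).real (A a))
      (fun b => (hV b).mul (hG.aestronglyMeasurable hd hX hsep hloc a b (hA a))) fun ω => by
        rw [norm_mul]
        refine mul_le_one₀ (hVc ω) (norm_nonneg _) ?_
        rw [Real.norm_of_nonneg measureReal_nonneg]
        exact measureReal_le_one
    simp_rw [Finset.prod_insert ha]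
    calc _ = ∫ ω, (V * fun ω => ∏ t ∈ T, (X t ⁻¹' A t).indicator (fun _ => (1 : ℝ)) ω) ω *
            (X a ⁻¹' A a).indicator (fun _ => (1 : ℝ)) ω ∂P := by
          congr 1 with ω; simp only [Pi.mul_apply]; ring
      _ = ∫ ω, V ω * (G a ω).real (A a) *
            ∏ t ∈ T, (X t ⁻¹' A t).indicator (fun _ => (1 : ℝ)) ω ∂P := by
          rw [step]; congr 1 with ω; simp only [Pi.mul_apply]; ring
      _ = _ := by rw [step2]; congr 1 with ω; ring

lemma processSigmaAlgebra_le {G : I → Ω → Measure E} (hG : ∀ t, Measurable (G t)) :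
    processSigmaAlgebra G ≤ ‹MeasurableSpace Ω› :=
  iSup_le fun t => (hG t).comap_le

/-- Makes indicators of σ(G)-events admissible weights in `integral_prod_eq`; the inclusion holds
only modulo null sets. -/
lemma IsCoordCondLaw.processSigmaAlgebra_le {G : I → Ω → Measure E} (hG : IsCoordCondLaw P X G)
    (hd : IsUnitPremetric d) (hX : ∀ t, Measurable (X t))
    (hsep : ∀ t, ∀ ε : ℝ, 0 < ε → {r | d r t < ε}.Infinite)
    (hloc : IsLocallyExchangeable P X d) (a : I) :
    processSigmaAlgebra G ≤ eventuallyMeasurableSpace (coordSigma X {a}ᶜ) (ae P) := by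
  have := hG.isProbabilityMeasure
  refine iSup_le fun t => Measurable.comap_le ?_
  refine @Measure.measurable_of_measurable_coe _ _ _
    (eventuallyMeasurableSpace (coordSigma X {a}ᶜ) (ae P)) _ fun A hA => ?_
  obtain ⟨f, hf, hGf⟩ := hG.aestronglyMeasurable hd hX hsep hloc t a hA
  have hreal : EventuallyMeasurable (coordSigma X {a}ᶜ) (ae P) fun ω => (G t ω).real A :=
    hf.measurable.eventuallyMeasurable_of_eventuallyEq hGf
  have h := ENNReal.measurable_ofReal.comp hreal
  have e : (fun ω => G t ω A) = ENNReal.ofReal ∘ fun ω => (G t ω).real A := by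
    ext ω
    simp
  rw [e]
  exact h

lemma measurable_measure_pi {ι Y E : Type*} [Fintype ι] {_ : MeasurableSpace Y}
    [MeasurableSpace E] {κ : ι → Y → Measure E} [∀ i y, IsProbabilityMeasure (κ i y)]
    (hκ : ∀ i, Measurable (κ i)) : Measurable fun y => Measure.pi fun i => κ i y := by
  refine Measurable.measure_of_isPiSystem_of_isProbabilityMeasure generateFrom_pi.symm
    isPiSystem_pi ?_
  rintro _ ⟨A, hA, rfl⟩
  simp_rw [Measure.pi_pi]
  exact Finset.measurable_fun_prod _ fun i _ =>
    (Measure.measurable_coe (hA i (Set.mem_univ i))).comp (hκ i)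

lemma measureReal_bind_restrict {P : Measure Ω} {Y : Type*} [MeasurableSpace Y] {κ : Ω → Measure Y}
    [∀ ω, IsProbabilityMeasure (κ ω)] (hκ : Measurable κ) (W : Set Ω) {B : Set Y}
    (hB : MeasurableSet B) :
    ((P.restrict W).bind κ).real B = ∫ ω in W, (κ ω).real B ∂P := by
  have h : Measurable fun ω => κ ω B := (Measure.measurable_coe hB).comp hκ
  rw [measureReal_def, Measure.bind_apply hB hκ.aemeasurable]
  exact (integral_toReal h.aemeasurable (ae_of_all _ fun ω => measure_lt_top _ _)).symm

lemma IsCoordCondLaw.condLaw {G : I → Ω → Measure E} (hG : IsCoordCondLaw P X G)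
    (hd : IsUnitPremetric d) (hX : ∀ t, Measurable (X t))
    (hsep : ∀ t, ∀ ε : ℝ, 0 < ε → {r | d r t < ε}.Infinite)
    (hloc : IsLocallyExchangeable P X d) (T : Finset I) (B : Set (T → E))
    (hB : MeasurableSet B) :
    P[((fun ω (t : T) => X t.1 ω) ⁻¹' B).indicator (fun _ => (1 : ℝ)) | processSigmaAlgebra G]
      =ᵐ[P] fun ω => (Measure.pi (fun t : T => G t.1 ω)).real B := by
  classical
  have := hG.isProbabilityMeasure
  have hle := _root_.processSigmaAlgebra_le hG.measurable
  have hXT : Measurable fun ω (t : T) => X t.1 ω := measurable_pi_lambda _ fun t => hX _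
  have hGσ : Measurable[processSigmaAlgebra G] fun ω => Measure.pi (fun t : T => G t.1 ω) :=
    measurable_measure_pi (κ := fun (t : T) ω => G t.1 ω) fun t =>
      Measurable.mono (comap_measurable _)
        (le_iSup (fun t => MeasurableSpace.comap (G t) inferInstance) t.1) le_rfl
  have hGm := hGσ.mono hle le_rfl
  have hBσ : Measurable[processSigmaAlgebra G]
      fun ω => (Measure.pi (fun t : T => G t.1 ω)).real B :=
    ((Measure.measurable_coe hB).comp hGσ).ennreal_toReal
  refine (ae_eq_condExp_of_forall_setIntegral_eq hle
    ((integrable_const _).indicator (hXT hB)) (fun _ _ _ => ?_) (fun W hW _ => ?_)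
    hBσ.aestronglyMeasurable).symm
  · refine Integrable.integrableOn (Integrable.of_bound
      (hBσ.mono hle le_rfl).aestronglyMeasurable 1 (ae_of_all _ fun ω => ?_))
    rw [Real.norm_of_nonneg measureReal_nonneg]
    exact measureReal_le_one
  have hWm := hle _ hW
  rw [← measureReal_bind_restrict hGm W hB, integral_indicator (hXT hB), setIntegral_const,
    smul_eq_mul, mul_one, ← map_measureReal_apply hXT hB]
  have : IsFiniteMeasure ((P.restrict W).bind fun ω => Measure.pi (fun t : T => G t.1 ω)) := by
    refine ⟨?_⟩
    rw [Measure.bind_apply MeasurableSet.univ hGm.aemeasurable]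
    simp
  -- Equality of two finite measures on the product space, so that checking rectangles suffices.
  suffices h : (P.restrict W).bind (fun ω => Measure.pi (fun t : T => G t.1 ω))
      = (P.restrict W).map fun ω (t : T) => X t.1 ω by rw [h]
  have hrect : ∀ A : T → Set E, (∀ t, MeasurableSet (A t)) →
      (P.restrict W).bind (fun ω => Measure.pi (fun t : T => G t.1 ω)) (Set.pi Set.univ A)
        = (P.restrict W).map (fun ω (t : T) => X t.1 ω) (Set.pi Set.univ A) := by
    intro A hA
    have hAm : MeasurableSet (Set.pi Set.univ A) := MeasurableSet.univ_pi hA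
    rw [← ENNReal.toReal_eq_toReal_iff' (measure_ne_top _ _) (measure_ne_top _ _),
      ← measureReal_def, ← measureReal_def, measureReal_bind_restrict hGm W hAm,
      map_measureReal_apply hXT hAm]
    let A' : I → Set E := fun i => if h : i ∈ T then A ⟨i, h⟩ else Set.univ
    have hA'T : ∀ t : T, A' t.1 = A t := fun t => by simp [A']
    have hA' : ∀ i, MeasurableSet (A' i) := fun i => by
      by_cases h : i ∈ T
      · simpa [A', h] using hA ⟨i, h⟩
      · simp [A', h]
    have key := hG.integral_prod_eq hd hX hsep hloc T hA' (W.indicator fun _ => (1 : ℝ))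
      (fun a => by
        obtain ⟨W', hW', hWW'⟩ := hG.processSigmaAlgebra_le hd hX hsep hloc a _ hW
        exact ⟨W'.indicator fun _ => (1 : ℝ),
          (measurable_const.indicator hW').stronglyMeasurable,
          indicator_ae_eq_of_ae_eq_set hWW'⟩)
      (fun ω => by
        rw [Real.norm_of_nonneg (Set.indicator_nonneg (fun _ _ => zero_le_one) ω)]
        exact Set.indicator_apply_le' (fun _ => le_rfl) fun _ => zero_le_one)
    have e : ∀ f : Ω → ℝ, ∫ ω, W.indicator (fun _ => (1 : ℝ)) ω * f ω ∂P = ∫ ω in W, f ω ∂P :=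
      fun f => by
        rw [← integral_indicator hWm]
        congr 1 with ω
        by_cases h : ω ∈ W <;> simp [h]
    rw [e, e] at key
    have e1 : ∀ ω, (Measure.pi (fun t : T => G t.1 ω)).real (Set.pi Set.univ A)
        = ∏ t ∈ T, (G t ω).real (A' t) := fun ω => by
      rw [measureReal_def, Measure.pi_pi, ENNReal.toReal_prod,
        ← Finset.prod_coe_sort T fun t => (G t ω).real (A' t)]
      simp_rw [hA'T, measureReal_def]
    have e2 : ∀ ω, ∏ t ∈ T, (X t ⁻¹' A' t).indicator (fun _ => (1 : ℝ)) ω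
        = ((fun ω (t : T) => X t.1 ω) ⁻¹' Set.pi Set.univ A).indicator (fun _ => (1 : ℝ)) ω :=
      fun ω => by
        rw [← Finset.prod_coe_sort T fun t => (X t ⁻¹' A' t).indicator (fun _ => (1 : ℝ)) ω]
        simp_rw [hA'T]
        simp only [Set.indicator_apply, Set.mem_preimage, Set.mem_pi, Set.mem_univ, true_imp_iff]
        rw [Finset.prod_ite_zero]
        simp
    simp_rw [e1, ← key, e2]
    rw [integral_indicator (hXT hAm), setIntegral_const, smul_eq_mul, mul_one]
  refine ext_of_generate_finite _ generateFrom_pi.symm isPiSystem_pi ?_ ?_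
  · rintro _ ⟨A, hA, rfl⟩
    exact hrect A fun t => hA t (Set.mem_univ t)
  · simpa using hrect (fun _ => Set.univ) fun _ => MeasurableSet.univ

end

/-! ### The L¹ bound. -/

section

variable {I Ω E : Type*} [MeasurableSpace Ω] [MeasurableSpace E] {P : Measure Ω}
  [IsProbabilityMeasure P] {d : I → I → ℝ} {X : I → Ω → E}

/-- Both differences are packed into the one event `A ×ˢ B ∪ Aᶜ ×ˢ Bᶜ`. Bounding them separately
would give `2 * d s t`. -/
lemma IsLocallyExchangeable.measureReal_inter_sub_le (hd : IsUnitPremetric d)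
    (hX : ∀ t, Measurable (X t)) (hloc : IsLocallyExchangeable P X d) {s t : I} {A : Set E}
    (hA : MeasurableSet A) {Q : Set Ω} (hQ : MeasurableSet[coordSigma X {s, t}ᶜ] Q) :
    P.real (Q ∩ X s ⁻¹' A) - P.real (Q ∩ X t ⁻¹' A)
      - (P.real (Qᶜ ∩ X s ⁻¹' A) - P.real (Qᶜ ∩ X t ⁻¹' A)) ≤ d s t := by
  refine le_of_forall_pos_le_add fun ε hε => ?_
  -- Four probabilities are approximated, each with error below `ε / 4`.
  obtain ⟨R, hR, B, hB, hlt⟩ := exists_cylinder_approx (P := P) hX hQ (ε := ε / 4) (by positivity)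
  have hRm : Measurable fun ω (r : R) => X r ω := measurable_pi_lambda _ fun r => hX _
  set Q' : Set Ω := (fun ω (r : R) => X r ω) ⁻¹' B with hQ'
  have hQm : MeasurableSet Q := coordSigma_le hX _ _ hQ
  have hQ'm : MeasurableSet Q' := hRm hB
  have hlt' : P.real (symmDiff Q Q') < ε / 4 := hlt
  have hltc : P.real (symmDiff Qᶜ Q'ᶜ) < ε / 4 := by rwa [compl_symmDiff_compl]
  have h1 := abs_measureReal_inter_sub_le (P := P) hQm hQ'm (hX s hA)
  have h2 := abs_measureReal_inter_sub_le (P := P) hQm hQ'm (hX t hA)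
  have h3 := abs_measureReal_inter_sub_le (P := P) hQm.compl hQ'm.compl (hX s hA)
  have h4 := abs_measureReal_inter_sub_le (P := P) hQm.compl hQ'm.compl (hX t hA)
  have hsR : s ∉ R := fun h => hR h (by simp)
  have htR : t ∉ R := fun h => hR h (by simp)
  have key := hloc.abs_sub_le hd hX hsR htR (B := A ×ˢ B ∪ Aᶜ ×ˢ Bᶜ)
    ((hA.prod hB).union (hA.compl.prod hB.compl))
  have e : ∀ r : I, P.real {ω | (X r ω, fun r : R => X r ω) ∈ A ×ˢ B ∪ Aᶜ ×ˢ Bᶜ}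
      = P.real (Q' ∩ X r ⁻¹' A) + (P.real Q'ᶜ - P.real (Q'ᶜ ∩ X r ⁻¹' A)) := by
    intro r
    have e1 : {ω | (X r ω, fun r : R => X r ω) ∈ A ×ˢ B ∪ Aᶜ ×ˢ Bᶜ}
        = (Q' ∩ X r ⁻¹' A) ∪ (Q'ᶜ \ X r ⁻¹' A) := by
      ext ω
      simp [Q', and_comm]
    have e2 := measureReal_inter_add_sdiff (μ := P) (s := Q'ᶜ) (hX r hA)
    rw [e1, measureReal_union ?_ (hQ'm.compl.diff (hX r hA))]
    · linarith
    · exact Set.disjoint_left.2 fun ω h h' => h'.1 h.1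
  rw [e, e] at key
  rw [abs_le] at h1 h2 h3 h4 key
  linarith

lemma IsCoordCondLaw.smooth {G : I → Ω → Measure E} (hG : IsCoordCondLaw P X G)
    (hd : IsUnitPremetric d) (hX : ∀ t, Measurable (X t))
    (hsep : ∀ t, ∀ ε : ℝ, 0 < ε → {r | d r t < ε}.Infinite)
    (hloc : IsLocallyExchangeable P X d) (s t : I) {A : Set E} (hA : MeasurableSet A) :
    ∫ ω, |(G s ω).real A - (G t ω).real A| ∂P ≤ d s t := by
  rcases eq_or_ne s t with rfl | hst
  · simp [hd.self]
  have hm := coordSigma_le hX {s, t}ᶜ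
  set f := P[(X s ⁻¹' A).indicator (fun _ => (1 : ℝ)) | coordSigma X {s, t}ᶜ] with hf
  set g := P[(X t ⁻¹' A).indicator (fun _ => (1 : ℝ)) | coordSigma X {s, t}ᶜ] with hg
  have hs : (fun ω => (G s ω).real A) =ᵐ[P] f := hG.condExp_pair_eq hd hX hsep hloc hst hA
  have ht : (fun ω => (G t ω).real A) =ᵐ[P] g := by
    have := hG.condExp_pair_eq hd hX hsep hloc hst.symm hA
    rwa [Set.pair_comm] at this
  have hfi : Integrable f P := integrable_condExp
  have hgi : Integrable g P := integrable_condExp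
  -- The set where `f - g` is nonnegative turns the integral of `|f - g|` into a signed combination
  -- of probabilities.
  have hQ : MeasurableSet[coordSigma X {s, t}ᶜ] {ω | g ω ≤ f ω} :=
    stronglyMeasurable_condExp.measurableSet_le stronglyMeasurable_condExp
  have hval : ∀ (r : I) (Q : Set Ω), MeasurableSet[coordSigma X {s, t}ᶜ] Q →
      ∫ ω in Q, (P[(X r ⁻¹' A).indicator (fun _ => (1 : ℝ)) | coordSigma X {s, t}ᶜ]) ω ∂P
        = P.real (Q ∩ X r ⁻¹' A) := fun r Q hQ => by
    rw [setIntegral_condExp hm ((integrable_const _).indicator (hX r hA)) hQ,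
      setIntegral_indicator (hX r hA), setIntegral_const, smul_eq_mul, mul_one]
  calc ∫ ω, |(G s ω).real A - (G t ω).real A| ∂P = ∫ ω, |f ω - g ω| ∂P := by
        refine integral_congr_ae ?_
        filter_upwards [hs, ht] with ω h1 h2
        rw [h1, h2]
    _ = ∫ ω in {ω | g ω ≤ f ω}, |f ω - g ω| ∂P + ∫ ω in {ω | g ω ≤ f ω}ᶜ, |f ω - g ω| ∂P :=
        (integral_add_compl (hm _ hQ) (hfi.sub hgi).abs).symm
    _ = ∫ ω in {ω | g ω ≤ f ω}, (f ω - g ω) ∂P - ∫ ω in {ω | g ω ≤ f ω}ᶜ, (f ω - g ω) ∂P := by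
        rw [sub_eq_add_neg, ← integral_neg]
        congr 1
        · exact setIntegral_congr_fun (hm _ hQ) fun ω hω => abs_of_nonneg (sub_nonneg.2 hω)
        · exact setIntegral_congr_fun (hm _ hQ).compl fun ω (hω : ¬ g ω ≤ f ω) =>
            abs_of_nonpos (sub_nonpos.2 (not_le.1 hω).le)
    _ ≤ d s t := by
        rw [integral_sub hfi.integrableOn hgi.integrableOn,
          integral_sub hfi.integrableOn hgi.integrableOn, hval s _ hQ, hval t _ hQ,
          hval s _ hQ.compl, hval t _ hQ.compl]
        exact hloc.measureReal_inter_sub_le hd hX hA hQ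

lemma IsCoordCondLaw.isDeFinettiProcess {G : I → Ω → Measure E} (hG : IsCoordCondLaw P X G)
    (hd : IsUnitPremetric d) (hX : ∀ t, Measurable (X t))
    (hsep : ∀ t, ∀ ε : ℝ, 0 < ε → {r | d r t < ε}.Infinite)
    (hloc : IsLocallyExchangeable P X d) : IsDeFinettiProcess P X d G where
  measurable := hG.measurable
  isProbabilityMeasure := hG.isProbabilityMeasure
  condLaw := hG.condLaw hd hX hsep hloc
  smooth s t _ hA := hG.smooth hd hX hsep hloc s t hA

/-! ### Uniqueness and continuity, for an arbitrary de Finetti process. -/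

namespace IsDeFinettiProcess

variable {G G' : I → Ω → Measure E}

lemma measurable_real {P : Measure Ω} (hG : IsDeFinettiProcess P X d G) (t : I) {A : Set E}
    (hA : MeasurableSet A) : Measurable fun ω => (G t ω).real A :=
  ((Measure.measurable_coe hA).comp (hG.measurable t)).ennreal_toReal

lemma norm_real_le {P : Measure Ω} (hG : IsDeFinettiProcess P X d G) (t : I) (A : Set E) (ω : Ω) :
    ‖(G t ω).real A‖ ≤ 1 := by
  have := hG.isProbabilityMeasure t ω
  rw [Real.norm_of_nonneg measureReal_nonneg]
  exact measureReal_le_one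

lemma integrable_real (hG : IsDeFinettiProcess P X d G) (t : I) {A : Set E}
    (hA : MeasurableSet A) : Integrable (fun ω => (G t ω).real A) P :=
  .of_bound (hG.measurable_real t hA).aestronglyMeasurable 1 (ae_of_all _ (hG.norm_real_le t A))

lemma condExp_prod {P : Measure Ω} (hG : IsDeFinettiProcess P X d G) (T : Finset I)
    {A : Set E} (hA : MeasurableSet A) :
    P[fun ω => ∏ t ∈ T, (X t ⁻¹' A).indicator (fun _ => (1 : ℝ)) ω | processSigmaAlgebra G]
      =ᵐ[P] fun ω => ∏ t ∈ T, (G t ω).real A := by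
  classical
  have := hG.isProbabilityMeasure
  have h := hG.condLaw T (Set.pi Set.univ fun _ => A) (MeasurableSet.univ_pi fun _ => hA)
  have e1 : (fun ω => (Measure.pi fun t : T => G t.1 ω).real (Set.pi Set.univ fun _ => A))
      = fun ω => ∏ t ∈ T, (G t ω).real A := by
    ext ω
    rw [measureReal_def, Measure.pi_pi, ENNReal.toReal_prod,
      ← Finset.prod_coe_sort T fun t => (G t ω).real A]
    rfl
  have e2 : ((fun ω (t : T) => X t.1 ω) ⁻¹' Set.pi Set.univ fun _ => A).indicator
        (fun _ => (1 : ℝ))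
      = fun ω => ∏ t ∈ T, (X t ⁻¹' A).indicator (fun _ => (1 : ℝ)) ω := by
    ext ω
    rw [← Finset.prod_coe_sort T fun t => (X t ⁻¹' A).indicator (fun _ => (1 : ℝ)) ω]
    simp only [Set.indicator_apply, Set.mem_preimage, Set.mem_pi, Set.mem_univ, true_imp_iff]
    rw [Finset.prod_ite_zero]
    simp
  rwa [e1, e2] at h

/-- For `r ≠ q`, conditioning on `G` replaces both indicators by `G r A` and `G q A`. One factor is
then bounded by 1 and the other by the L¹ bound. -/
lemma integral_sub_mul_sub_le (hG : IsDeFinettiProcess P X d G) (hX : ∀ t, Measurable (X t))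
    {r q t : I} (hrq : r ≠ q) {A : Set E} (hA : MeasurableSet A) :
    ∫ ω, ((X r ⁻¹' A).indicator (fun _ => (1 : ℝ)) ω - (G t ω).real A)
        * ((X q ⁻¹' A).indicator (fun _ => (1 : ℝ)) ω - (G t ω).real A) ∂P ≤ d r t := by
  classical
  set y : I → Ω → ℝ := fun r => (X r ⁻¹' A).indicator fun _ => (1 : ℝ) with hy
  set g : I → Ω → ℝ := fun r ω => (G r ω).real A with hg
  change ∫ ω, (y r ω - g t ω) * (y q ω - g t ω) ∂P ≤ d r t
  have hle := processSigmaAlgebra_le hG.measurable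
  have hym : ∀ r, Measurable (y r) := fun r => measurable_const.indicator (hX r hA)
  have hyb : ∀ r ω, ‖y r ω‖ ≤ 1 := fun r ω => by
    by_cases h : ω ∈ X r ⁻¹' A <;> simp [hy, h]
  have hgm : ∀ r, Measurable (g r) := fun r => hG.measurable_real r hA
  have hgb : ∀ r ω, ‖g r ω‖ ≤ 1 := fun r ω => hG.norm_real_le r A ω
  have hgσ : StronglyMeasurable[processSigmaAlgebra G] (g t) :=
    (Measurable.ennreal_toReal ((Measure.measurable_coe hA).comp
      (Measurable.mono (comap_measurable (G t))
        (le_iSup (fun t => MeasurableSpace.comap (G t) inferInstance) t)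
        le_rfl))).stronglyMeasurable
  have hint : ∀ {u v : Ω → ℝ}, Measurable u → Measurable v → (∀ ω, ‖u ω‖ ≤ 1) →
      (∀ ω, ‖v ω‖ ≤ 1) → Integrable (fun ω => u ω * v ω) P := fun hu hv hu1 hv1 =>
    .of_bound (hu.mul hv).aestronglyMeasurable 1 (ae_of_all _ fun ω => by
      rw [norm_mul]; exact mul_le_one₀ (hu1 ω) (norm_nonneg _) (hv1 ω))
  have h1 : ∫ ω, y r ω * y q ω ∂P = ∫ ω, g r ω * g q ω ∂P := by
    have h := hG.condExp_prod {r, q} hA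
    simp_rw [Finset.prod_pair hrq] at h
    rw [← integral_condExp hle]
    exact integral_congr_ae h
  have h2 : ∀ r, ∫ ω, g t ω * y r ω ∂P = ∫ ω, g t ω * g r ω ∂P := fun r => by
    have h := hG.condExp_prod {r} hA
    simp_rw [Finset.prod_singleton] at h
    have h' := condExp_stronglyMeasurable_mul_of_bound (μ := P) hle hgσ
      (Integrable.of_bound (hym r).aestronglyMeasurable 1 (ae_of_all _ (hyb r))) 1
      (ae_of_all _ (hgb t))
    have h'' : ∫ ω, (g t * y r) ω ∂P = _ := (integral_condExp hle).symm.trans (integral_congr_ae h')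
    refine h''.trans (integral_congr_ae ?_)
    filter_upwards [h] with ω hω
    rw [Pi.mul_apply]
    exact congrArg _ hω
  have expand : ∀ u v : Ω → ℝ, Measurable u → Measurable v → (∀ ω, ‖u ω‖ ≤ 1) →
      (∀ ω, ‖v ω‖ ≤ 1) → ∫ ω, (u ω - g t ω) * (v ω - g t ω) ∂P
        = ∫ ω, u ω * v ω ∂P - ∫ ω, g t ω * u ω ∂P - ∫ ω, g t ω * v ω ∂P
          + ∫ ω, g t ω * g t ω ∂P := fun u v hu hv hu1 hv1 => by
    have i1 := hint hu hv hu1 hv1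
    have i2 := hint (hgm t) hu (hgb t) hu1
    have i3 := hint (hgm t) hv (hgb t) hv1
    have i4 := hint (hgm t) (hgm t) (hgb t) (hgb t)
    have i5 : Integrable (fun ω => u ω * v ω - g t ω * u ω) P := i1.sub i2
    have i6 : Integrable (fun ω => u ω * v ω - g t ω * u ω - g t ω * v ω) P := i5.sub i3
    rw [← integral_sub i1 i2, ← integral_sub i5 i3, ← integral_add i6 i4]
    congr 1 with ω
    ring
  calc ∫ ω, (y r ω - g t ω) * (y q ω - g t ω) ∂P
      = ∫ ω, (g r ω - g t ω) * (g q ω - g t ω) ∂P := by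
        rw [expand _ _ (hym r) (hym q) (hyb r) (hyb q),
          expand _ _ (hgm r) (hgm q) (hgb r) (hgb q), h1, h2, h2]
    _ ≤ ∫ ω, |g r ω - g t ω| ∂P := by
        have hi := ((hG.integrable_real r hA).sub (hG.integrable_real t hA)).abs
        refine integral_mono (.of_bound (((hgm r).sub (hgm t)).mul
          ((hgm q).sub (hgm t))).aestronglyMeasurable ((1 + 1) * (1 + 1)) (ae_of_all _ fun ω => ?_))
          hi fun ω => ?_
        · rw [norm_mul]
          exact mul_le_mul ((norm_sub_le _ _).trans (add_le_add (hgb r ω) (hgb t ω)))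
            ((norm_sub_le _ _).trans (add_le_add (hgb q ω) (hgb t ω))) (norm_nonneg _) (by norm_num)
        · have h1 : |g q ω - g t ω| ≤ 1 := by
            have := hG.isProbabilityMeasure
            exact abs_sub_le_of_nonneg_of_le measureReal_nonneg measureReal_le_one
              measureReal_nonneg measureReal_le_one
          refine (le_abs_self _).trans ?_
          rw [abs_mul]
          exact mul_le_of_le_one_right (abs_nonneg _) h1
    _ ≤ d r t := hG.smooth r t A hA

/-- Diagonal terms contribute at most `T.card`. Off-diagonal ones are at most `ε` each, so dividing
by the squared cardinality leaves `1 / T.card + ε`. -/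
lemma integral_sq_sum_le (hG : IsDeFinettiProcess P X d G) (hX : ∀ t, Measurable (X t))
    {t : I} {T : Finset I} {ε : ℝ} (hε : 0 ≤ ε) (hT : ∀ r ∈ T, d r t ≤ ε) {A : Set E}
    (hA : MeasurableSet A) :
    ∫ ω, (∑ r ∈ T, ((X r ⁻¹' A).indicator (fun _ => (1 : ℝ)) ω - (G t ω).real A)) ^ 2 ∂P
      ≤ T.card + ε * (T.card : ℝ) ^ 2 := by
  classical
  have := hG.isProbabilityMeasure
  set z : I → Ω → ℝ := fun r ω =>
    (X r ⁻¹' A).indicator (fun _ => (1 : ℝ)) ω - (G t ω).real A with hz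
  have hzm : ∀ r, Measurable (z r) := fun r =>
    (measurable_const.indicator (hX r hA)).sub (hG.measurable_real t hA)
  have hzb : ∀ r ω, ‖z r ω‖ ≤ 1 := fun r ω =>
    abs_sub_le_of_nonneg_of_le (Set.indicator_nonneg (fun _ _ => zero_le_one) ω)
      (Set.indicator_apply_le' (fun _ => le_rfl) fun _ => zero_le_one) measureReal_nonneg
      measureReal_le_one
  have hb : ∀ r q ω, ‖z r ω * z q ω‖ ≤ 1 := fun r q ω => by
    rw [norm_mul]; exact mul_le_one₀ (hzb r ω) (norm_nonneg _) (hzb q ω)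
  have hint : ∀ r q, Integrable (fun ω => z r ω * z q ω) P := fun r q =>
    .of_bound ((hzm r).mul (hzm q)).aestronglyMeasurable 1 (ae_of_all _ (hb r q))
  have hle : ∀ r ∈ T, ∀ q ∈ T, ∫ ω, z r ω * z q ω ∂P ≤ (if r = q then 1 else 0) + ε := by
    intro r hr q hq
    split_ifs with h
    · calc ∫ ω, z r ω * z q ω ∂P ≤ ∫ _, (1 : ℝ) ∂P :=
            integral_mono (hint r q) (integrable_const _) fun ω =>
              (Real.le_norm_self _).trans (hb r q ω)
        _ ≤ 1 + ε := by simpa using hε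
    · rw [zero_add]
      exact (hG.integral_sub_mul_sub_le hX h hA).trans (hT r hr)
  calc ∫ ω, (∑ r ∈ T, z r ω) ^ 2 ∂P = ∑ r ∈ T, ∑ q ∈ T, ∫ ω, z r ω * z q ω ∂P := by
        simp_rw [sq, Finset.sum_mul_sum]
        rw [integral_finsetSum _ fun r _ => integrable_finsetSum _ fun q _ => hint r q]
        exact Finset.sum_congr rfl fun r _ => integral_finsetSum _ fun q _ => hint r q
    _ ≤ ∑ r ∈ T, ∑ q ∈ T, ((if r = q then 1 else 0) + ε) :=
        Finset.sum_le_sum fun r hr => Finset.sum_le_sum fun q hq => hle r hr q hq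
    _ = T.card + ε * (T.card : ℝ) ^ 2 := by
        simp only [Finset.sum_add_distrib, Finset.sum_ite_eq, Finset.sum_const, nsmul_eq_mul,
          Finset.sum_ite_mem, Finset.inter_self]
        ring

lemma real_ae_eq (hG : IsDeFinettiProcess P X d G) (hG' : IsDeFinettiProcess P X d G')
    (hX : ∀ t, Measurable (X t)) (hsep : ∀ t, ∀ ε : ℝ, 0 < ε → {r | d r t < ε}.Infinite)
    (t : I) {A : Set E} (hA : MeasurableSet A) :
    (fun ω => (G' t ω).real A) =ᵐ[P] fun ω => (G t ω).real A := by
  set D : Ω → ℝ := fun ω => (G' t ω).real A - (G t ω).real A with hD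
  have hDm : Measurable D := (hG'.measurable_real t hA).sub (hG.measurable_real t hA)
  have bdd_int : ∀ {u : Ω → ℝ} {c : ℝ}, Measurable u → (∀ ω, ‖u ω‖ ≤ c) →
      Integrable (fun ω => u ω ^ 2) P := fun {u c} hu hc =>
    .of_bound (hu.pow_const 2).aestronglyMeasurable (c ^ 2) (ae_of_all _ fun ω => by
      rw [norm_pow]; exact pow_le_pow_left₀ (norm_nonneg _) (hc ω) 2)
  have hD2 : Integrable (fun ω => D ω ^ 2) P := bdd_int hDm (c := 1 + 1) fun ω =>
    (norm_sub_le _ _).trans (add_le_add (hG'.norm_real_le t A ω) (hG.norm_real_le t A ω))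
  have hzero : ∫ ω, D ω ^ 2 ∂P ≤ 0 := by
    refine le_of_forall_pos_le_add fun ε hε => ?_
    -- With radius `ε / 8` the final bound is `4 * n + ε * n ^ 2 / 2`, which is at most `ε * n ^ 2`
    -- once `n * ε ≥ 8`.
    obtain ⟨n, hn⟩ := exists_nat_gt (8 / ε)
    have hn0 : (0 : ℝ) < n := (by positivity : 0 < 8 / ε).trans hn
    obtain ⟨T, hT, hTn⟩ := (hsep t (ε / 8) (by positivity)).exists_subset_card_eq n
    have hT' : ∀ r ∈ T, d r t ≤ ε / 8 := fun r hr => (hT hr).le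
    have b1 := hG.integral_sq_sum_le hX (by positivity) hT' hA
    have b2 := hG'.integral_sq_sum_le hX (by positivity) hT' hA
    rw [hTn] at b1 b2
    have hint : ∀ {H : I → Ω → Measure E}, IsDeFinettiProcess P X d H → Integrable (fun ω =>
        (∑ r ∈ T, ((X r ⁻¹' A).indicator (fun _ => (1 : ℝ)) ω - (H t ω).real A)) ^ 2) P := by
      intro H hH
      refine bdd_int (c := ∑ r ∈ T, (1 + 1)) (Finset.measurable_fun_sum T fun r _ =>
        (measurable_const.indicator (hX r hA)).sub (hH.measurable_real t hA)) fun ω => ?_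
      refine norm_sum_le_of_le T fun r _ =>
        (norm_sub_le _ _).trans (add_le_add ?_ (hH.norm_real_le t A ω))
      by_cases h : ω ∈ X r ⁻¹' A <;> simp [h]
    have hmain : ∫ ω, (n : ℝ) ^ 2 * D ω ^ 2 ∂P
        ≤ 2 * (n + ε / 8 * (n : ℝ) ^ 2) + 2 * (n + ε / 8 * (n : ℝ) ^ 2) := by
      calc ∫ ω, (n : ℝ) ^ 2 * D ω ^ 2 ∂P
          ≤ ∫ ω, (2 * (∑ r ∈ T, ((X r ⁻¹' A).indicator (fun _ => (1 : ℝ)) ω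
              - (G t ω).real A)) ^ 2 + 2 * (∑ r ∈ T, ((X r ⁻¹' A).indicator (fun _ => (1 : ℝ)) ω
              - (G' t ω).real A)) ^ 2) ∂P := by
            refine integral_mono (hD2.const_mul _)
              (((hint hG).const_mul 2).add ((hint hG').const_mul 2)) fun ω => ?_
            simp only [Finset.sum_sub_distrib, Finset.sum_const, nsmul_eq_mul, hTn, hD]
            -- This is `(x - y) ^ 2 ≤ 2 * x ^ 2 + 2 * y ^ 2` for the two centred sums, whose
            -- difference is `n * D`: the observations cancel.
            nlinarith [sq_nonneg ((∑ r ∈ T, (X r ⁻¹' A).indicator (fun _ => (1 : ℝ)) ω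
              - n * (G t ω).real A) + (∑ r ∈ T, (X r ⁻¹' A).indicator (fun _ => (1 : ℝ)) ω
              - n * (G' t ω).real A))]
        _ ≤ _ := by
            rw [integral_add ((hint hG).const_mul 2) ((hint hG').const_mul 2),
              integral_const_mul, integral_const_mul]
            linarith
    rw [integral_const_mul] at hmain
    have hn' : 8 < n * ε := (div_lt_iff₀ hε).1 hn
    have : (n : ℝ) ^ 2 * ∫ ω, D ω ^ 2 ∂P ≤ (n : ℝ) ^ 2 * (0 + ε) := by nlinarith
    exact le_of_mul_le_mul_left this (by positivity)
  have h0 := (integral_eq_zero_iff_of_nonneg (fun ω => sq_nonneg (D ω)) hD2).1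
    (le_antisymm hzero (integral_nonneg fun ω => sq_nonneg (D ω)))
  filter_upwards [h0] with ω hω
  exact sub_eq_zero.1 (pow_eq_zero_iff two_ne_zero |>.1 hω)

/-- A countable generating algebra allows a single null set for all its members, and it is a
π-system determining the measure. -/
lemma ae_eq [MeasurableSpace.CountablyGenerated E] (hG : IsDeFinettiProcess P X d G)
    (hG' : IsDeFinettiProcess P X d G')
    (hX : ∀ t, Measurable (X t)) (hsep : ∀ t, ∀ ε : ℝ, 0 < ε → {r | d r t < ε}.Infinite)
    (t : I) : G' t =ᵐ[P] G t := by
  set C := generateSetAlgebra (MeasurableSpace.countableGeneratingSet E) with hC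
  have hCalg : IsSetAlgebra C := isSetAlgebra_generateSetAlgebra
  have hCc : C.Countable :=
    countable_generateSetAlgebra (MeasurableSpace.countable_countableGeneratingSet)
  have hgen : ‹MeasurableSpace E› = MeasurableSpace.generateFrom C := by
    rw [generateFrom_generateSetAlgebra_eq, MeasurableSpace.generateFrom_countableGeneratingSet]
  have hCm : ∀ A ∈ C, MeasurableSet A := fun A hA => by
    rw [hgen]
    exact MeasurableSpace.measurableSet_generateFrom hA
  have hae : ∀ᵐ ω ∂P, ∀ A ∈ C, (G' t ω).real A = (G t ω).real A :=
    (ae_ball_iff hCc).2 fun A hA => hG.real_ae_eq hG' hX hsep t (hCm A hA)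
  filter_upwards [hae] with ω hω
  have := hG.isProbabilityMeasure t ω
  have := hG'.isProbabilityMeasure t ω
  refine ext_of_generate_finite C hgen (fun A hA B hB _ => hCalg.inter_mem hA hB) (fun A hA => ?_) (by simp)
  exact (ENNReal.toReal_eq_toReal_iff' (measure_ne_top _ _) (measure_ne_top _ _)).1 (hω A hA)

lemma tendsto_iSup (hG : IsDeFinettiProcess P X d G) {A : Set E} (hA : MeasurableSet A) (t₀ : I)
    {ε : ℝ} (hε : 0 < ε) :
    Tendsto (fun η : ℝ => ⨆ (t : I) (_ : d t t₀ ≤ η),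
      P {ω | ε < |(G t ω).real A - (G t₀ ω).real A|}) (𝓝[>] 0) (𝓝 0) := by
  have hlim : Tendsto (fun η : ℝ => ENNReal.ofReal (η / ε)) (𝓝[>] 0) (𝓝 0) := by
    have : Tendsto (fun η : ℝ => ENNReal.ofReal (η / ε)) (𝓝 0) (𝓝 (ENNReal.ofReal (0 / ε))) :=
      (ENNReal.continuous_ofReal.tendsto _).comp (tendsto_id.div_const ε)
    rw [zero_div, ENNReal.ofReal_zero] at this
    exact this.mono_left nhdsWithin_le_nhds
  refine tendsto_of_tendsto_of_tendsto_of_le_of_le tendsto_const_nhds hlim (fun _ => zero_le)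
    fun η => iSup₂_le fun t ht => ?_
  have hi := ((hG.integrable_real t hA).sub (hG.integrable_real t₀ hA)).abs
  have hmarkov := mul_meas_ge_le_integral_of_nonneg (ae_of_all _ fun ω => abs_nonneg _) hi ε
  calc P {ω | ε < |(G t ω).real A - (G t₀ ω).real A|}
      ≤ P {ω | ε ≤ |(G t ω).real A - (G t₀ ω).real A|} := 
        measure_mono fun ω (hω : ε < |(G t ω).real A - (G t₀ ω).real A|) => hω.le
    _ = ENNReal.ofReal (P.real {ω | ε ≤ |(G t ω).real A - (G t₀ ω).real A|}) := by simp
    _ ≤ ENNReal.ofReal (η / ε) := by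
        refine ENNReal.ofReal_le_ofReal ((le_div_iff₀' hε).2 ?_)
        exact hmarkov.trans ((hG.smooth t t₀ A hA).trans ht)

end IsDeFinettiProcess

end

theorem mainTheorem10 {I Ω E : Type*} [MeasurableSpace Ω] [MeasurableSpace E]
    [StandardBorelSpace E] (P : Measure Ω) [IsProbabilityMeasure P]
    (d : I → I → ℝ) (hd : IsUnitPremetric d) (hsep : IsInfinitelySeparable d)
    (X : I → Ω → E) (hX : ∀ t, Measurable (X t)) (hloc : IsLocallyExchangeable P X d) :
    ∃ G : I → Ω → Measure E,
      IsDeFinettiProcess P X d G ∧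
      (∀ G' : I → Ω → Measure E, IsDeFinettiProcess P X d G' → ∀ t, G' t =ᵐ[P] G t) ∧
      ∀ (A : Set E), MeasurableSet A → ∀ (t₀ : I) (ε : ℝ), 0 < ε →
        Tendsto
          (fun η : ℝ => ⨆ (t : I) (_ : d t t₀ ≤ η),
            P {ω | ε < |(G t ω).real A - (G t₀ ω).real A|})
          (𝓝[>] 0) (𝓝 0) := by
  have hsep' : ∀ t, ∀ ε : ℝ, 0 < ε → {r | d r t < ε}.Infinite :=
    fun t ε hε => hsep.infinite_setOf_lt t hε
  obtain ⟨G, hG⟩ := exists_isCoordCondLaw P hX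
  have hGd := hG.isDeFinettiProcess hd hX hsep' hloc
  exact ⟨G, hGd, fun G' hG' t => hGd.ae_eq hG' hX hsep' t,
    fun A hA t₀ ε hε => hGd.tendsto_iSup hA t₀ hε⟩
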